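/- Let $K$ be a field with $\operatorname{char} K\neq 2,3$. Let $F$ be the free group freely generated by the variables $x_0,x_1,x_2,\dots$ and $y_1,y_2,\dots$. An element $u\in KF$ is an *identity* of a representation $\rho:G\to\operatorname{Aut}_K V$ if, for every substitution of elements of $G$ for the variables, the resulting element of $KG$ annihilates $V$. A set $U\subseteq KF$ is a *basis of identities* of a representation $\rho_0$ if all elements of $U$ are identities of $\rho_0$ and the variety defined by $U$ (the class of all representations over $K$ for which all elements of $U$ are identities) coincides with the variety generated by $\rho_0$ (the class of all representations over $K$ satisfying all identities of $\rho_0$). For a disjunction $\delta=(f_1=1)\vee\dots\vee(f_n=1)$ of equations, where $f_1,\dots,f_n$ are words in the variables $x_i$ and an equation $a=b$ is read as $ab^{-1}=1$, put $$\delta^*=(f_1^{y_1}-1)(f_2^{y_2}-1)\cdots(f_n^{y_n}-1)\in KF,\qquad f^{y}=y^{-1}fy .$$ Write $a\in\langle b\rangle$ for the disjunction $(a=1)\vee(a=b)\vee(a=b^2)\vee(a=b^3)$, write $[a,b]=a^{-1}b^{-1}ab$, and put $$\omega_{24}=\bigvee_{0\le i<j\le 24}(x_i=x_j),$$ $$\theta=\Big[\bigvee_{\substack{1\le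 i,j\le 3\\ i\ne j}}x_i\in\langle x_j\rangle\Big]\vee\Big[\bigvee_{\sigma\in S_3}x_{\sigma(1)}\in\langle x_{\sigma(2)}x_{\sigma(3)}\rangle\Big]\vee\Big[\bigvee_{\sigma\in S_3}x_{\sigma(1)}x_{\sigma(2)}\in\langle x_{\sigma(2)}x_{\sigma(3)}\rangle\Big],$$ $$\delta_{10}=(x_1^4=1)\vee(x_2^4=1)\vee((x_1x_2)^4=1)\vee((x_1x_2^2)^4=1),$$ $$\delta_{11}=(x_1^3=1)\vee(x_1^4=1),$$ $$\delta_{12}=(x_1^6=1)\vee(x_2^6=1)\vee(x_1=x_2)\vee(x_1x_2=1)\vee((x_1x_2)^3=1),$$ $$\delta_{13}=(x_1^3=1)\vee(x_2^3=1)\vee(x_3^3=1)\vee((x_1^{-1}x_2)^3=1)\vee((x_1^{-1}x_3)^3=1)\vee((x_2^{-1}x_3)^3=1)\vee\theta,$$ where indexed disjunctions are taken in the lexicographic order of $(i,j)$, respectively of $(\sigma(1),\sigma(2),\sigma(3))$. Then the elements $$\omega_{24}^*,\quad \delta_{10}^*,\quad \delta_{11}^*,\quad \delta_{12}^*,\quad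 \delta_{13}^*,\quad x_1^{12}-1,\quad [[[x_1,x_2],[x_3,x_4]],[[x_5,x_6],[x_7,x_8]]]-1$$ of $KF$ form a basis of identities of the regular representation $\operatorname{Reg}_K S_4=(KS_4,S_4)$ of the symmetric group $S_4$ over $K$. -/

import Mathlib

universe u v w u₀ v₀

namespace RegIdentities

/-- The free group `F` of countable rank. Its free generators are split into two infinite
sequences: the variables `x i` and the auxiliary variables `y k`. -/
abbrev F : Type := FreeGroup (ℕ ⊕ ℕ)

/-- The variable `x_i`. -/
def x (i : ℕ) : F := FreeGroup.of (Sum.inl i)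

/-- The auxiliary variable `y_k`. -/
def y (k : ℕ) : F := FreeGroup.of (Sum.inr k)

section Identities

variable {K : Type w} [Field K]

/-- `u ∈ KF` is an identity of the representation `ρ` of `G` on `V`: for every substitution `g`
of elements of `G` for the variables, the resulting element of `KG` annihilates `V`. -/
def IsIdentity {G : Type*} {V : Type*} [Group G] [AddCommGroup V] [Module K V]
    (ρ : Representation K G V) (p : MonoidAlgebra K F) : Prop :=
  ∀ g : ℕ ⊕ ℕ → G,
    ρ.asAlgebraHom (MonoidAlgebra.mapDomainAlgHom K K (FreeGroup.lift g) p) = 0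

/-- The set of all identities of a representation. -/
def identities {G : Type*} {V : Type*} [Group G] [AddCommGroup V] [Module K V]
    (ρ : Representation K G V) : Set (MonoidAlgebra K F) :=
  {p | IsIdentity ρ p}

/-- `ρ` belongs to the variety of representations defined by the set of identities `U`. -/
def InVariety (U : Set (MonoidAlgebra K F)) {G : Type*} {V : Type*} [Group G] [AddCommGroup V]
    [Module K V] (ρ : Representation K G V) : Prop :=
  ∀ p ∈ U, IsIdentity ρ p

/-- `U` is a basis of identities of `ρ₀`: the elements of `U` are identities of `ρ₀`, and the
variety defined by `U` is the variety generated by `ρ₀`, which is the class of all representations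
that satisfy all the identities of `ρ₀`. The groups range over `Type u`, the
spaces over `Type v`. -/
def IsBasisOfIdentities (U : Set (MonoidAlgebra K F)) {G₀ : Type u₀} {V₀ : Type v₀} [Group G₀]
    [AddCommGroup V₀] [Module K V₀] (ρ₀ : Representation K G₀ V₀) : Prop :=
  U ⊆ identities ρ₀ ∧
    ∀ (G : Type u) (V : Type v) [Group G] [AddCommGroup V] [Module K V]
      (ρ : Representation K G V),
      InVariety U ρ ↔ InVariety (identities ρ₀) ρ

variable (K) in
/-- The element `f - 1` of `KF`, for `f ∈ F`. -/
noncomputable def subOne (f : F) : MonoidAlgebra K F := MonoidAlgebra.of K F f - 1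

variable (K) in
/-- For the disjunctive identity `δ = (f_1 = 1) ∨ ... ∨ (f_n = 1)`, given as the list
`[f_1, ..., f_n]` of words in the variables `x i`, the element
`δ* = (f_1^{y_1} - 1) ... (f_n^{y_n} - 1)` of `KF`, where `f^y = y⁻¹ f y`. -/
noncomputable def starElem (δ : List F) : MonoidAlgebra K F :=
  (δ.mapIdx fun k f => subOne K ((y k)⁻¹ * f * y k)).prod

end Identities

/-! Disjunctive identities, as lists of words. An equation `a = b` is the word `a * b⁻¹`. -/

/-- `ω_n`: the disjunction of all `x_i = x_j` with `0 ≤ i < j ≤ n`. -/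
def omega (n : ℕ) : List F :=
  (List.range (n + 1)).flatMap fun i =>
    ((List.range (n + 1)).filter (i < ·)).map fun j => x i * (x j)⁻¹

/-- `a ∈ ⟨b⟩`, that is, `(a = 1) ∨ (a = b) ∨ (a = b²) ∨ (a = b³)`. -/
def memPowers (a b : F) : List F :=
  [a, a * b⁻¹, a * (b ^ 2)⁻¹, a * (b ^ 3)⁻¹]

/-- The ordered pairs `(i, j)` with `i ≠ j` in `{1, 2, 3}`. -/
def pairs : List (ℕ × ℕ) :=
  [(1, 2), (1, 3), (2, 1), (2, 3), (3, 1), (3, 2)]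

/-- The triples `(σ 1, σ 2, σ 3)` with `σ ∈ S_3`. -/
def triples : List (ℕ × ℕ × ℕ) :=
  [(1, 2, 3), (1, 3, 2), (2, 1, 3), (2, 3, 1), (3, 1, 2), (3, 2, 1)]

/-- `[⋁_{i ≠ j} x_i ∈ ⟨x_j⟩] ∨ [⋁_σ x_{σ(1)} ∈ ⟨x_{σ(2)} x_{σ(3)}⟩]
∨ [⋁_σ x_{σ(1)} x_{σ(2)} ∈ ⟨x_{σ(2)} x_{σ(3)}⟩]`. -/
def theta : List F :=
  (pairs.flatMap fun (i, j) => memPowers (x i) (x j)) ++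
  (triples.flatMap fun (i, j, k) => memPowers (x i) (x j * x k)) ++
  (triples.flatMap fun (i, j, k) => memPowers (x i * x j) (x j * x k))

/-- `(x_1^4 = 1) ∨ (x_2^4 = 1) ∨ ((x_1 x_2)^4 = 1) ∨ ((x_1 x_2^2)^4 = 1)`. -/
def delta10 : List F :=
  [x 1 ^ 4, x 2 ^ 4, (x 1 * x 2) ^ 4, (x 1 * x 2 ^ 2) ^ 4]

/-- `(x^3 = 1) ∨ (x^4 = 1)`. -/
def delta11 : List F :=
  [x 1 ^ 3, x 1 ^ 4]

/-- `(x_1^6 = 1) ∨ (x_2^6 = 1) ∨ (x_1 = x_2) ∨ (x_1 x_2 = 1) ∨ ((x_1 x_2)^3 = 1)`. -/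
def delta12 : List F :=
  [x 1 ^ 6, x 2 ^ 6, x 1 * (x 2)⁻¹, x 1 * x 2, (x 1 * x 2) ^ 3]

/-- `(x_1^3 = 1) ∨ (x_2^3 = 1) ∨ (x_3^3 = 1) ∨ ((x_1⁻¹ x_2)^3 = 1) ∨ ((x_1⁻¹ x_3)^3 = 1)
∨ ((x_2⁻¹ x_3)^3 = 1) ∨ θ`. -/
def delta13 : List F :=
  [x 1 ^ 3, x 2 ^ 3, x 3 ^ 3,
    ((x 1)⁻¹ * x 2) ^ 3, ((x 1)⁻¹ * x 3) ^ 3, ((x 2)⁻¹ * x 3) ^ 3] ++ theta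

/-- The commutator `[a, b] = a⁻¹ b⁻¹ a b`. -/
def comm (a b : F) : F := a⁻¹ * b⁻¹ * a * b

/-- The word `[[[x_1, x_2], [x_3, x_4]], [[x_5, x_6], [x_7, x_8]]]`. -/
def solvWord : F :=
  comm (comm (comm (x 1) (x 2)) (comm (x 3) (x 4)))
    (comm (comm (x 5) (x 6)) (comm (x 7) (x 8)))

/-- The elements `ω_24*`, the four `δ*`, `x^12 - 1`, and the `3`-solvability identity. -/
noncomputable def basisS4 (K : Type w) [Field K] : Set (MonoidAlgebra K F) :=
  {starElem K (omega 24), starElem K delta10, starElem K delta11, starElem K delta12, starElem K delta13,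
    subOne K (x 1 ^ 12), subOne K solvWord}

end RegIdentities

namespace RegIdentities

/-!
An identity of `ρ` may be checked on the finitely generated subgroups of the group. If `ρ` satisfies
the proposed basis, then the image of such a subgroup in `GL(V)` is a finitely generated solvable
torsion group, hence finite, and its order is prime to `char K` because its exponent divides `12`.
By Maschke's theorem `ρ` may then be assumed irreducible.

The vectors fixed by all conjugates of a group element `f` form a subrepresentation, which for
irreducible `ρ` is `0` or `V`. Hence if the product of the `f_k^{y_k} - 1` annihilates `V` for all
choices of the `y_k`, then some `f_k` acts trivially: the image of `ρ` satisfies the disjunctions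
`ω_24, δ_10, …, δ_13` themselves.

A finite group `Q` satisfying these embeds in `S_4`. If `c ∈ Q` has order `3`, then `δ_10` and
`δ_11` make `⟨c⟩` its own centralizer, hence a Sylow subgroup whose normalizer `N` has order `3` or
`6`; as `|Q| ≤ 24` and `7` does not divide `|Q|`, either `Q` acts faithfully on the at most four
cosets of `N`, or `Q = N`. If there is no such `c`, then `Q` has exponent dividing `4`. If `a` has
order `4`, then by `δ_12` all elements outside `⟨a⟩` are involutions, and `Q` is cyclic or dihedral;
otherwise `Q` is elementary abelian, of order at most `4` by `δ_13`. Finally, an identity of `KS_4`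
holds in every representation of every subgroup of `S_4`.
-/

section Embedding

variable {Q : Type*} [Group Q] [Finite Q] {n : ℕ}

theorem exists_embedding_of_normalCore_eq_bot {H : Subgroup Q} (hcore : H.normalCore = ⊥)
    (hindex : H.index ≤ n) : ∃ f : Q →* Equiv.Perm (Fin n), Function.Injective f := by
  have := Fintype.ofFinite (Q ⧸ H)
  have hcard : Fintype.card (Q ⧸ H) ≤ Fintype.card (Fin n) := by
    rw [Fintype.card_eq_nat_card, Fintype.card_fin]
    exact hindex
  obtain ⟨e⟩ := Function.Embedding.nonempty_of_card_le hcard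
  refine ⟨(Equiv.Perm.viaEmbeddingHom e).comp (MulAction.toPermHom Q (Q ⧸ H)),
    (Equiv.Perm.viaEmbeddingHom_injective e).comp ?_⟩
  rw [← MonoidHom.ker_eq_bot_iff, ← Subgroup.normalCore_eq_ker, hcore]

theorem exists_embedding_of_card_le (hcard : Nat.card Q ≤ n) :
    ∃ f : Q →* Equiv.Perm (Fin n), Function.Injective f :=
  exists_embedding_of_normalCore_eq_bot (H := ⊥) (eq_bot_iff.2 (Subgroup.normalCore_le _))
    (by simpa using hcard)

end Embedding

section SylowTheory

variable {G : Type*} [Group G]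

theorem disjoint_or_le_of_prime_card (K : Subgroup G) {H : Subgroup G}
    (hH : (Nat.card H).Prime) : Disjoint K H ∨ H ≤ K := by
  have : Fact (Nat.card H).Prime := ⟨hH⟩
  rw [← Subgroup.subgroupOf_eq_bot, ← Subgroup.subgroupOf_eq_top]
  exact Subgroup.eq_bot_or_eq_top_of_prime_card _

theorem normalCore_eq_bot_of_prime_card {H : Subgroup G} (hH : (Nat.card H).Prime)
    (hnormal : ¬ H.Normal) : H.normalCore = ⊥ := by
  have hcore := H.normalCore_le
  refine (disjoint_or_le_of_prime_card H.normalCore hH).elim (fun h => h.eq_bot_of_le hcore) ?_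
  intro hle
  exact absurd (le_antisymm hcore hle ▸ H.normalCore_normal) hnormal

theorem exists_embedding_of_involution [Finite G] {n : ℕ} {t c : G} (ht : orderOf t = 2)
    (hc : ¬ Commute c t) (hcard : Nat.card G ≤ 2 * n) :
    ∃ f : G →* Equiv.Perm (Fin n), Function.Injective f := by
  have hcardt : Nat.card (Subgroup.zpowers t) = 2 := by rw [Nat.card_zpowers, ht]
  have ht1 : t ≠ 1 := fun h => by simp [h] at ht
  refine exists_embedding_of_normalCore_eq_bot (H := Subgroup.zpowers t)
    (normalCore_eq_bot_of_prime_card (hcardt ▸ Nat.prime_two) fun hnormal => hc ?_) ?_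
  · have ht := Subgroup.mem_zpowers t
    have huniq := ((Nat.card_eq_two_iff' (1 : Subgroup.zpowers t)).1 hcardt).unique
      (y₁ := ⟨c * t * c⁻¹, hnormal.conj_mem t ht c⟩) (y₂ := ⟨t, ht⟩)
      (by simpa [Subtype.ext_iff] using ht1) (by simpa [Subtype.ext_iff] using ht1)
    exact mul_inv_eq_iff_eq_mul.1 (congrArg Subtype.val huniq)
  · have h := (Subgroup.zpowers t).card_mul_index
    rw [hcardt] at h
    omega

theorem exists_sylow_eq_of_centralizer_le [Finite G] {p : ℕ} [Fact p.Prime] {H : Subgroup G}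
    (hH : Nat.card H = p) (hself : Subgroup.centralizer (H : Set G) ≤ H) :
    ∃ P : Sylow p G, (P : Subgroup G) = H := by
  have hp : p.Prime := Fact.out
  obtain ⟨S, hHS⟩ := (IsPGroup.of_card (n := 1) (by rw [hH, pow_one])).exists_le_sylow
  have : Nontrivial S := by
    rw [← Finite.one_lt_card_iff_nontrivial]
    exact (hH ▸ hp.one_lt).trans_le (Subgroup.card_le_of_le hHS)
  have hcenter : (Subgroup.center S).map (S : Subgroup G).subtype ≤ H := by
    rintro _ ⟨z, hz, rfl⟩
    exact hself fun h hh => congrArg Subtype.val (Subgroup.mem_center_iff.1 hz ⟨h, hHS hh⟩)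
  have hHcenter : H ≤ (Subgroup.center S).map (S : Subgroup G).subtype := by
    refine (disjoint_or_le_of_prime_card _ (hH ▸ hp)).resolve_left fun hdisj => ?_
    have hbot := hdisj.eq_bot_of_le hcenter
    rw [Subgroup.map_eq_bot_iff_of_injective _ (Subgroup.subtype_injective _)] at hbot
    exact S.isPGroup'.bot_lt_center.ne' hbot
  refine ⟨S, le_antisymm (fun s hs => hself fun h hh => ?_) hHS⟩
  obtain ⟨z, hz, rfl⟩ := hHcenter hh
  exact (congrArg Subtype.val (Subgroup.mem_center_iff.1 hz ⟨s, hs⟩)).symm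

theorem card_normalizer_dvd_of_centralizer_le [Finite G] {H : Subgroup G} [IsCyclic H]
    (hself : Subgroup.centralizer (H : Set G) ≤ H) :
    Nat.card (Subgroup.normalizer (H : Set G)) ∣ Nat.card H * (Nat.card H).totient := by
  have hindex := Subgroup.card_dvd_of_injective _
    (QuotientGroup.kerLift_injective H.normalizerMonoidHom)
  rw [IsCyclic.card_mulAut, ← Subgroup.index_eq_card, Subgroup.normalizerMonoidHom_ker] at hindex
  rw [← Subgroup.card_mul_index ((Subgroup.centralizer (H : Set G)).subgroupOf _)]
  refine mul_dvd_mul ?_ hindex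
  rw [Nat.card_congr (Subgroup.subgroupOfEquivOfLe
    (Subgroup.centralizer_le_normalizer (H : Set G))).toEquiv]
  exact Subgroup.card_dvd_of_le hself

theorem sylow_normal_of_le_normalizer [Finite G] {p : ℕ} [Fact p.Prime] {P : Sylow p G}
    (hP : (Nat.card P).Prime) (hself : Subgroup.centralizer (P : Set G) ≤ P) {M : Subgroup G}
    [M.Normal] (hM : M ≠ ⊥) (hMP : M ≤ Subgroup.normalizer (P : Set G)) :
    (P : Subgroup G).Normal := by
  suffices hle : (P : Subgroup G) ≤ M by
    rw [← Subgroup.normalizer_eq_top_iff, ← P.normalizer_sup_eq_top' hle]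
    exact (sup_eq_left.2 hMP).symm
  refine (disjoint_or_le_of_prime_card M hP).resolve_left fun hdisj => hM ?_
  have hcomm : ⁅M, (P : Subgroup G)⁆ ≤ M ⊓ P := by
    refine le_inf (Subgroup.commutator_le_left _ _) (Subgroup.commutator_le.2 fun m hm c hc => ?_)
    exact mul_mem ((Subgroup.mem_normalizer_iff.1 (hMP hm) c).1 hc) (inv_mem hc)
  rw [hdisj.eq_bot, le_bot_iff, Subgroup.commutator_eq_bot_iff_le_centralizer] at hcomm
  exact hdisj.eq_bot_of_le (hcomm.trans hself)

end SylowTheory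

section SmallGroups

variable {Q : Type*} [Group Q]

theorem index_le_two_of_mul_mem {H : Subgroup Q} (hmul : ∀ s ∉ H, ∀ t ∉ H, s * t ∈ H) :
    H.index ≤ 2 := by
  by_cases htop : H = ⊤
  · simp [htop]
  · obtain ⟨s, hs⟩ : ∃ s, s ∉ H := by simpa [Subgroup.eq_top_iff'] using htop
    refine (Subgroup.index_eq_two_iff.2 ⟨s, fun b => ?_⟩).le
    by_cases hb : b ∈ H
    · exact Or.inr ⟨hb, fun h => hs ((Subgroup.mul_mem_cancel_left _ hb).1 h)⟩
    · exact Or.inl ⟨hmul b hb s hs, hb⟩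

theorem conj_eq_inv_of_sq_eq_one {H : Subgroup Q} (hsq : ∀ t ∉ H, t ^ 2 = 1) {a t : Q}
    (ha : a ∈ H) (ht : t ∉ H) : t * a * t⁻¹ = a⁻¹ := by
  have hta : (t * a) * (t * a) = 1 := by
    rw [← pow_two]
    exact hsq _ fun h => ht ((Subgroup.mul_mem_cancel_right _ ha).1 h)
  rw [inv_eq_of_mul_eq_one_left (a := t) (by rw [← pow_two, hsq t ht])]
  exact eq_inv_of_mul_eq_one_left (by rwa [mul_assoc])

theorem index_le_two_of_sq_eq_one {H : Subgroup Q} (hsq : ∀ t ∉ H, t ^ 2 = 1) {a : Q}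
    (haH : a ∈ H) (ha : a ^ 2 ≠ 1) : H.index ≤ 2 := by
  refine index_le_two_of_mul_mem fun s hs t ht => by_contra fun hst => ha ?_
  have hinv : a⁻¹ = a := calc
    a⁻¹ = s * t * a * (s * t)⁻¹ := (conj_eq_inv_of_sq_eq_one hsq haH hst).symm
    _ = s * (t * a * t⁻¹) * s⁻¹ := by group
    _ = (s * a * s⁻¹)⁻¹ := by rw [conj_eq_inv_of_sq_eq_one hsq haH ht]; group
    _ = a := by rw [conj_eq_inv_of_sq_eq_one hsq haH hs, inv_inv]
  rw [pow_two, ← inv_eq_iff_mul_eq_one, hinv]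

theorem exists_embedding_of_orderOf_eq_four [Finite Q] {a : Q} (ha : orderOf a = 4)
    (hsq : ∀ t ∉ Subgroup.zpowers a, t ^ 2 = 1) :
    ∃ f : Q →* Equiv.Perm (Fin 4), Function.Injective f := by
  have ha2 : a ^ 2 ≠ 1 := fun h => by simpa [ha] using orderOf_dvd_of_pow_eq_one h
  have hindex := index_le_two_of_sq_eq_one hsq (Subgroup.mem_zpowers a) ha2
  have hcard := (Subgroup.zpowers a).card_mul_index
  rw [Nat.card_zpowers, ha] at hcard
  by_cases htop : Subgroup.zpowers a = ⊤
  · refine exists_embedding_of_card_le ?_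
    rw [← hcard, htop, Subgroup.index_top]
  · obtain ⟨t, ht⟩ : ∃ t, t ∉ Subgroup.zpowers a := by simpa [Subgroup.eq_top_iff'] using htop
    have ht1 : t ≠ 1 := fun h => ht (h ▸ one_mem _)
    refine exists_embedding_of_involution (c := a) (orderOf_eq_prime (hsq t ht) ht1) ?_
      (by omega)
    intro hcomm
    have hinv := conj_eq_inv_of_sq_eq_one hsq (Subgroup.mem_zpowers a) ht
    rw [← hcomm.eq, mul_inv_cancel_right] at hinv
    exact ha2 (by rw [pow_two]; nth_rewrite 2 [hinv]; exact mul_inv_cancel a)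

theorem exists_embedding_of_card_dvd_six [Finite Q] (hcard : Nat.card Q ∣ 6) {c : Q}
    (hc : orderOf c = 3) (hself : ∀ g, Commute g c → g ∈ Subgroup.zpowers c) :
    ∃ f : Q →* Equiv.Perm (Fin 4), Function.Injective f := by
  have hle := Nat.le_of_dvd (by norm_num) hcard
  by_cases heven : 2 ∣ Nat.card Q
  · have : Fact (Nat.Prime 2) := ⟨Nat.prime_two⟩
    obtain ⟨t, ht⟩ := exists_prime_orderOf_dvd_card' 2 heven
    refine exists_embedding_of_involution ht (c := c) (fun hcomm => ?_) (by omega)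
    have hdvd := orderOf_dvd_of_mem_zpowers (hself t hcomm.symm)
    rw [ht, hc] at hdvd
    omega
  · refine exists_embedding_of_card_le ?_
    interval_cases Nat.card Q <;> omega

theorem exists_embedding_of_orderOf_eq_three [Finite Q] (hcard : Nat.card Q ≤ 24)
    (hseven : ¬ 7 ∣ Nat.card Q) {c : Q} (hc : orderOf c = 3)
    (hself : ∀ g, Commute g c → g ∈ Subgroup.zpowers c) :
    ∃ f : Q →* Equiv.Perm (Fin 4), Function.Injective f := by
  have : Fact (Nat.Prime 3) := ⟨Nat.prime_three⟩
  have hcard_c : Nat.card (Subgroup.zpowers c) = 3 := by rw [Nat.card_zpowers, hc]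
  have hcentralizer : Subgroup.centralizer (Subgroup.zpowers c : Set Q) ≤ Subgroup.zpowers c :=
    fun g hg => hself g (hg c (Subgroup.mem_zpowers c)).symm
  obtain ⟨P, hP⟩ := exists_sylow_eq_of_centralizer_le hcard_c hcentralizer
  set N := Subgroup.normalizer (P : Set Q) with hN
  have hN6 : Nat.card N ∣ 6 := by
    have hdvd := card_normalizer_dvd_of_centralizer_le hcentralizer
    rw [hcard_c, ← hP] at hdvd
    exact hdvd
  by_cases hcore : N.normalCore = ⊥
  · refine exists_embedding_of_normalCore_eq_bot hcore ?_
    have hmod := card_sylow_modEq_one 3 Q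
    rw [Sylow.card_eq_index_normalizer P, ← hN, Nat.ModEq] at hmod
    have hN3 : 3 ≤ Nat.card N := hcard_c ▸ hP ▸ Subgroup.card_le_of_le Subgroup.le_normalizer
    have hmul := N.card_mul_index
    have hne : N.index ≠ 7 := fun h => hseven (h ▸ N.index_dvd_card)
    have hle : N.index ≤ 8 := by nlinarith
    omega
  · have hnormal := sylow_normal_of_le_normalizer (hP ▸ hcard_c ▸ Nat.prime_three)
      (by rw [← P.coe_coe, hP]; exact hcentralizer) hcore N.normalCore_le
    rw [← Subgroup.normalizer_eq_top_iff] at hnormal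
    rw [hN, ← P.coe_coe, hnormal, Subgroup.card_top] at hN6
    exact exists_embedding_of_card_dvd_six hN6 hc hself

end SmallGroups

section Laws

variable {Q : Type*} [Group Q]

/-- `Q` satisfies the disjunctive identity `δ`: every substitution sends some word of `δ` to `1`. -/
def Satisfies (δ : List F) (Q : Type*) [Group Q] : Prop :=
  ∀ g : ℕ ⊕ ℕ → Q, ∃ f ∈ δ, FreeGroup.lift g f = 1

/-- The word `f` is a law of the group `Q`: it takes the value `1` under all substitutions. -/
def IsLaw (f : F) (Q : Type*) [Group Q] : Prop :=
  ∀ g : ℕ ⊕ ℕ → Q, FreeGroup.lift g f = 1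

/-- The substitution `x 1 ↦ a`, `x 2 ↦ b`, `x 3 ↦ c`; all other variables go to `1`. -/
def substitution (a b c : Q) : ℕ ⊕ ℕ → Q :=
  Sum.elim (fun i => if i = 1 then a else if i = 2 then b else if i = 3 then c else 1) 1

theorem satisfies_delta10_iff : Satisfies delta10 Q ↔
    ∀ a b : Q, a ^ 4 = 1 ∨ b ^ 4 = 1 ∨ (a * b) ^ 4 = 1 ∨ (a * b ^ 2) ^ 4 = 1 := by
  refine ⟨fun h a b => ?_, fun h g => ?_⟩
  · simpa [delta10, x, substitution] using h (substitution a b 1)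
  · simpa [delta10, x] using h (g (Sum.inl 1)) (g (Sum.inl 2))

theorem satisfies_delta11_iff : Satisfies delta11 Q ↔ ∀ a : Q, a ^ 3 = 1 ∨ a ^ 4 = 1 := by
  refine ⟨fun h a => ?_, fun h g => ?_⟩
  · simpa [delta11, x, substitution] using h (substitution a 1 1)
  · simpa [delta11, x] using h (g (Sum.inl 1))

theorem satisfies_delta12_iff : Satisfies delta12 Q ↔
    ∀ a b : Q, a ^ 6 = 1 ∨ b ^ 6 = 1 ∨ a = b ∨ a * b = 1 ∨ (a * b) ^ 3 = 1 := by
  refine ⟨fun h a b => ?_, fun h g => ?_⟩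
  · simpa [delta12, x, substitution, mul_inv_eq_one] using h (substitution a b 1)
  · simpa [delta12, x, mul_inv_eq_one] using h (g (Sum.inl 1)) (g (Sum.inl 2))

theorem exists_mem_memPowers_iff (φ : F →* Q) (a b : F) :
    (∃ f ∈ memPowers a b, φ f = 1) ↔ ∃ k : Fin 4, φ a = φ b ^ (k : ℕ) := by
  simp [memPowers, mul_inv_eq_one, Fin.exists_fin_succ]

/-- The pairs `(u, v)` for which `θ`, evaluated at `a, b, c`, offers the disjunct `u ∈ ⟨v⟩`. -/
def thetaPairs (a b c : Q) : List (Q × Q) :=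
  [(a, b), (a, c), (b, a), (b, c), (c, a), (c, b),
    (a, b * c), (a, c * b), (b, a * c), (b, c * a), (c, a * b), (c, b * a),
    (a * b, b * c), (a * c, c * b), (b * a, a * c), (b * c, c * a), (c * a, a * b),
    (c * b, b * a)]

theorem exists_mem_theta_iff (φ : F →* Q) :
    (∃ f ∈ theta, φ f = 1) ↔
      ∃ p ∈ thetaPairs (φ (x 1)) (φ (x 2)) (φ (x 3)), ∃ k : Fin 4, p.1 = p.2 ^ (k : ℕ) := by
  simp only [theta, pairs, triples, thetaPairs, List.flatMap_cons, List.flatMap_nil,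
    List.mem_append, List.mem_cons, List.not_mem_nil, or_and_right, exists_or,
    exists_mem_memPowers_iff, exists_eq_left, or_false, or_assoc, map_mul]

theorem exists_mem_delta13_iff (φ : F →* Q) :
    (∃ f ∈ delta13, φ f = 1) ↔ φ (x 1) ^ 3 = 1 ∨ φ (x 2) ^ 3 = 1 ∨
      ((φ (x 1))⁻¹ * φ (x 2)) ^ 3 = 1 ∨ φ (x 3) ^ 3 = 1 ∨ ((φ (x 1))⁻¹ * φ (x 3)) ^ 3 = 1 ∨
        ((φ (x 2))⁻¹ * φ (x 3)) ^ 3 = 1 ∨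
          ∃ p ∈ thetaPairs (φ (x 1)) (φ (x 2)) (φ (x 3)), ∃ k : Fin 4, p.1 = p.2 ^ (k : ℕ) := by
  simp only [← exists_mem_theta_iff, delta13, List.mem_append, List.mem_cons, List.not_mem_nil,
    or_and_right, exists_or, exists_eq_left, or_false, or_assoc, map_mul, map_inv, map_pow]
  tauto

/-- The quantifiers are nested so that a decision procedure can discard `a` or `(a, b)` early. -/
theorem satisfies_delta13_iff : Satisfies delta13 Q ↔
    ∀ a : Q, a ^ 3 = 1 ∨ ∀ b, b ^ 3 = 1 ∨ (a⁻¹ * b) ^ 3 = 1 ∨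
      ∀ c, c ^ 3 = 1 ∨ (a⁻¹ * c) ^ 3 = 1 ∨ (b⁻¹ * c) ^ 3 = 1 ∨
        ∃ p ∈ thetaPairs a b c, ∃ k : Fin 4, p.1 = p.2 ^ (k : ℕ) := by
  simp only [← forall_or_left]
  refine ⟨fun h a b c => ?_, fun h g => ?_⟩
  · have habc := (exists_mem_delta13_iff _).1 (h (substitution a b c))
    simpa [x, substitution] using habc
  · rw [exists_mem_delta13_iff]
    simpa [x] using h (g (Sum.inl 1)) (g (Sum.inl 2)) (g (Sum.inl 3))

theorem mem_omega_iff {n : ℕ} {f : F} :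
    f ∈ omega n ↔ ∃ i j, i < j ∧ j ≤ n ∧ x i * (x j)⁻¹ = f := by
  simp only [omega, List.mem_flatMap, List.mem_map, List.mem_filter, List.mem_range,
    decide_eq_true_eq]
  constructor
  · rintro ⟨i, -, j, ⟨hj, hij⟩, rfl⟩
    exact ⟨i, j, hij, by omega, rfl⟩
  · rintro ⟨i, j, hij, hj, rfl⟩
    exact ⟨i, by omega, j, ⟨by omega, hij⟩, rfl⟩

theorem satisfies_omega_iff [Finite Q] {n : ℕ} : Satisfies (omega n) Q ↔ Nat.card Q ≤ n := by
  have := Fintype.ofFinite Q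
  rw [Nat.card_eq_fintype_card]
  constructor
  · intro h
    by_contra! hlt
    obtain ⟨e⟩ := Function.Embedding.nonempty_of_card_le (α := Fin (n + 1)) (β := Q) (by simpa)
    obtain ⟨_, hf, h1⟩ := h (Sum.elim (fun i => e (Fin.ofNat (n + 1) i)) 1)
    obtain ⟨i, j, hij, hj, rfl⟩ := mem_omega_iff.1 hf
    have heq := e.injective (mul_inv_eq_one.1 (by simpa [x] using h1))
    rw [Fin.ext_iff, Fin.val_natCast, Fin.val_natCast, Nat.mod_eq_of_lt (by omega),
      Nat.mod_eq_of_lt (by omega)] at heq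
    omega
  · intro h g
    obtain ⟨i, j, hne, heq⟩ := Fintype.exists_ne_map_eq_of_card_lt
      (fun i : Fin (n + 1) => g (Sum.inl i)) (by simp; omega)
    wlog hij : i < j generalizing i j
    · exact this j i hne.symm heq.symm (lt_of_le_of_ne (not_lt.1 hij) hne.symm)
    exact ⟨_, mem_omega_iff.2 ⟨i, j, hij, by omega, rfl⟩, by simp [x, heq]⟩

theorem mem_zpowers_of_commute (h10 : Satisfies delta10 Q) (h11 : Satisfies delta11 Q) {c g : Q}
    (hc : orderOf c = 3) (hg : Commute g c) : g ∈ Subgroup.zpowers c := by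
  have hc3 : c ^ 3 = 1 := hc ▸ pow_orderOf_eq_one c
  have hc1 : c ≠ 1 := fun h => by simp [h] at hc
  have pow_four {a : Q} (ha : a ^ 3 = 1) : a ^ 4 = a := by rw [pow_succ, ha, one_mul]
  rcases satisfies_delta11_iff.1 h11 g with hg3 | hg4
  · have hcg : ∀ k : ℕ, (c * g ^ k) ^ 4 = 1 → c * g ^ k = 1 := fun k h => by
      rwa [pow_four] at h
      rw [(hg.symm.pow_right k).mul_pow, hc3, ← pow_mul, mul_comm k, pow_mul, hg3, one_pow, mul_one]
    have hgc : ∀ k : ℕ, c * g ^ k = 1 → g ^ k ∈ Subgroup.zpowers c := fun k h => by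
      rw [eq_inv_of_mul_eq_one_right h]
      exact inv_mem (Subgroup.mem_zpowers c)
    rcases satisfies_delta10_iff.1 h10 c g with h | h | h | h
    · exact absurd (pow_four hc3 ▸ h) hc1
    · rw [← pow_four hg3, h]
      exact one_mem _
    · simpa using hgc 1 (hcg 1 (by simpa using h))
    · have hg4 := pow_mem (hgc 2 (hcg 2 h)) 2
      rwa [← pow_mul, pow_four hg3] at hg4
  · rcases satisfies_delta11_iff.1 h11 (g * c) with h | h
    · rw [hg.mul_pow, hc3, mul_one] at h
      rw [pow_succ, h, one_mul] at hg4
      exact hg4 ▸ one_mem _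
    · rw [hg.mul_pow, hg4, one_mul, pow_four hc3] at h
      exact absurd h hc1

theorem eq_of_sq_eq_one_of_satisfies_delta13 (hsq : ∀ a : Q, a ^ 2 = 1)
    (h13 : Satisfies delta13 Q) {a b : Q} (ha : a ≠ 1) (hb : b ≠ 1) (hab : a ≠ b) (c : Q) :
    c = 1 ∨ c = a ∨ c = b ∨ c = a * b := by
  have hcomm (u v : Q) : u * v = v * u :=
    Commute.of_orderOf_dvd_two (fun a => orderOf_dvd_of_pow_eq_one (hsq a)) u v
  have hcube (u : Q) : u ^ 3 = u := by rw [pow_succ, hsq, one_mul]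
  have hmul (u : Q) : u * u = 1 := by rw [← pow_two, hsq]
  have hinv (u : Q) : u⁻¹ = u := inv_eq_of_mul_eq_one_left (hmul u)
  have heq {u v : Q} (h : u * v = 1) : u = v := by rw [eq_inv_of_mul_eq_one_left h, hinv]
  have hpow (u v : Q) : (∃ k : Fin 4, u = v ^ (k : ℕ)) ↔ u = 1 ∨ u = v := by
    simp only [Fin.exists_fin_succ, Fin.val_zero, Fin.val_succ, zero_add, Nat.reduceAdd, pow_zero,
      pow_one, hsq, hcube, IsEmpty.exists_iff]
    tauto
  have h := satisfies_delta13_iff.1 h13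
  simp only [hcube, hinv, thetaPairs, hpow, List.mem_cons, or_and_right, exists_or,
    exists_eq_left, List.not_mem_nil, or_false] at h
  have h := (((h a).resolve_left ha b).resolve_left hb).resolve_left (fun h => hab (heq h)) c
  have ha2 := hmul a
  have hb2 := hmul b
  have hc2 := hmul c
  -- Each remaining disjunct equates two products of distinct letters among `a`, `b`, `c`: it places
  -- `c` in `⟨a, b⟩` or contradicts `ha`, `hb` or `hab`.
  have : Std.Associative (α := Q) (· * ·) := ⟨mul_assoc⟩
  have : Std.Commutative (α := Q) (· * ·) := ⟨hcomm⟩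
  have : Std.LawfulIdentity (α := Q) (· * ·) 1 := inferInstance
  grind

theorem card_le_four_of_sq_eq_one (hsq : ∀ a : Q, a ^ 2 = 1) (h13 : Satisfies delta13 Q) :
    Nat.card Q ≤ 4 := by
  by_contra! hlt
  have : Finite Q := Nat.finite_of_card_ne_zero (by omega)
  have := Fintype.ofFinite Q
  rw [Nat.card_eq_fintype_card] at hlt
  have hcompl (s : Finset Q) (hs : s.card ≤ 4) : ∃ q, q ∉ s := by
    simpa using Finset.exists_mem_notMem_of_card_lt_card (hs.trans_lt hlt)
  classical
  obtain ⟨a, ha⟩ := hcompl {1} (by simp)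
  obtain ⟨b, hb⟩ := hcompl {1, a} (Finset.card_le_two.trans (by norm_num))
  obtain ⟨c, hc⟩ := hcompl {1, a, b, a * b} Finset.card_le_four
  simp only [Finset.mem_insert, Finset.mem_singleton, not_or] at ha hb hc
  have := eq_of_sq_eq_one_of_satisfies_delta13 hsq h13 ha hb.1 (Ne.symm hb.2) c
  tauto

theorem exists_embedding_of_satisfies [Finite Q] (h24 : Satisfies (omega 24) Q)
    (h10 : Satisfies delta10 Q) (h11 : Satisfies delta11 Q) (h12 : Satisfies delta12 Q)
    (h13 : Satisfies delta13 Q) :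
    ∃ f : Q →* Equiv.Perm (Fin 4), Function.Injective f := by
  have h11' := satisfies_delta11_iff.1 h11
  by_cases hc : ∃ c : Q, c ^ 3 = 1 ∧ c ≠ 1
  · obtain ⟨c, hc3, hc1⟩ := hc
    have hc := orderOf_eq_prime hc3 hc1
    have hseven : ¬ 7 ∣ Nat.card Q := fun h7 => by
      have : Fact (Nat.Prime 7) := ⟨by norm_num⟩
      obtain ⟨a, ha⟩ := exists_prime_orderOf_dvd_card' 7 h7
      rcases h11' a with h | h <;> exact absurd (orderOf_dvd_of_pow_eq_one h) (by rw [ha]; decide)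
    exact exists_embedding_of_orderOf_eq_three (satisfies_omega_iff.1 h24) hseven hc
      fun g => mem_zpowers_of_commute h10 h11 hc
  push Not at hc
  have hfour (a : Q) : a ^ 4 = 1 := (h11' a).elim (fun h => by simp [hc a h]) id
  by_cases ha : ∃ a : Q, a ^ 2 ≠ 1
  · obtain ⟨a, ha⟩ := ha
    have hsix (b : Q) (h : b ^ 6 = 1) : b ^ 2 = 1 := by
      rwa [pow_add b 4 2, hfour, one_mul] at h
    refine exists_embedding_of_orderOf_eq_four
      (orderOf_eq_prime_pow (p := 2) (n := 1) (by simpa using ha) (hfour a)) fun t ht => ?_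
    rcases satisfies_delta12_iff.1 h12 a t with h | h | h | h | h
    · exact absurd (hsix a h) ha
    · exact hsix t h
    · exact absurd (h ▸ Subgroup.mem_zpowers a) ht
    all_goals
      have hat : a * t = 1 := by first | exact h | exact hc _ h
      exact absurd (eq_inv_of_mul_eq_one_right hat ▸ inv_mem (Subgroup.mem_zpowers a)) ht
  · push Not at ha
    exact exists_embedding_of_card_le (card_le_four_of_sq_eq_one ha h13)

end Laws

section SymmetricGroup

open Equiv

theorem satisfies_omega_perm : Satisfies (omega 24) (Perm (Fin 4)) :=
  satisfies_omega_iff.2 (by rw [Nat.card_perm, Nat.card_fin]; rfl)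

theorem satisfies_delta10_perm : Satisfies delta10 (Perm (Fin 4)) :=
  satisfies_delta10_iff.2 (by decide +kernel)

theorem satisfies_delta11_perm : Satisfies delta11 (Perm (Fin 4)) :=
  satisfies_delta11_iff.2 (by decide +kernel)

theorem satisfies_delta12_perm : Satisfies delta12 (Perm (Fin 4)) :=
  satisfies_delta12_iff.2 (by decide +kernel)

theorem satisfies_delta13_perm : Satisfies delta13 (Perm (Fin 4)) :=
  satisfies_delta13_iff.2 (by decide +kernel)

theorem isLaw_pow_twelve_perm : IsLaw (x 1 ^ 12) (Perm (Fin 4)) := by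
  have hpow : ∀ a : Perm (Fin 4), a ^ 12 = 1 := by decide +kernel
  exact fun g => by rw [map_pow, hpow]

theorem derivedSeries_perm_eq_bot {α : Type*} (hα : Nat.card α = 4) :
    derivedSeries (Perm α) 3 = ⊥ := by
  classical
  have : Finite α := Nat.finite_of_card_ne_zero (by omega)
  have := Fintype.ofFinite α
  have h1 : derivedSeries (Perm α) 1 ≤ alternatingGroup α := by
    rw [derivedSeries_one]
    exact alternatingGroup.commutator_perm_le
  have h2 : derivedSeries (Perm α) 2 ≤
      (alternatingGroup.kleinFour α).map (alternatingGroup α).subtype := by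
    rw [derivedSeries_succ, alternatingGroup.kleinFour_eq_commutator hα,
      Subgroup.map_subtype_commutator]
    exact Subgroup.commutator_mono h1 h1
  have := alternatingGroup.kleinFour_isKleinFour hα
  have hV : ⁅alternatingGroup.kleinFour α, alternatingGroup.kleinFour α⁆ = ⊥ := by
    rw [Subgroup.commutator_self_eq_bot_iff]
    exact IsKleinFour.isMulCommutative
  rw [eq_bot_iff, derivedSeries_succ]
  refine (Subgroup.commutator_mono h2 h2).trans ?_
  rw [← Subgroup.map_commutator, hV, Subgroup.map_bot]

end SymmetricGroup

section SolvableLaw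

open scoped commutatorElement

variable {G : Type*} [Group G]

theorem closure_normal_of_conj_mem {A : Set G} (hA : ∀ a ∈ A, ∀ g : G, g * a * g⁻¹ ∈ A) :
    (Subgroup.closure A).Normal := by
  have hAA : Group.conjugatesOfSet A = A := by
    refine subset_antisymm (fun b hb => ?_) Group.subset_conjugatesOfSet
    obtain ⟨a, ha, hab⟩ := Group.mem_conjugatesOfSet_iff.1 hb
    obtain ⟨g, rfl⟩ := isConj_iff.1 hab
    exact hA a ha g
  rw [← hAA]
  exact Subgroup.normalClosure_normal

theorem commutator_closure_le {A B : Set G} {N : Subgroup G} [N.Normal]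
    (h : ∀ a ∈ A, ∀ b ∈ B, ⁅a, b⁆ ∈ N) : ⁅Subgroup.closure A, Subgroup.closure B⁆ ≤ N := by
  rw [← QuotientGroup.ker_mk' N, ← Subgroup.map_eq_bot_iff, Subgroup.map_commutator,
    MonoidHom.map_closure, MonoidHom.map_closure, Subgroup.commutator_eq_bot_iff_le_centralizer,
    Subgroup.centralizer_closure, Subgroup.closure_le]
  rintro _ ⟨a, ha, rfl⟩ _ ⟨b, hb, rfl⟩
  have hab := h a ha b hb
  rw [← QuotientGroup.ker_mk' N, MonoidHom.mem_ker, map_commutatorElement,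
    commutatorElement_eq_one_iff_mul_comm] at hab
  exact hab.symm

/-- The values in `G` of the iterated commutator words: `commValues G n` consists of the values
of the outer commutator word of derived length `n`, so that it generates `derivedSeries G n`. -/
def commValues (G : Type*) [Group G] : ℕ → Set G
  | 0 => Set.univ
  | n + 1 => {g | ∃ a ∈ commValues G n, ∃ b ∈ commValues G n, a⁻¹ * b⁻¹ * a * b = g}

theorem conj_mem_commValues (n : ℕ) {a : G} (ha : a ∈ commValues G n) (g : G) :
    g * a * g⁻¹ ∈ commValues G n := by
  induction n generalizing a with
  | zero => trivial
  | succ n ih =>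
    obtain ⟨b, hb, c, hc, rfl⟩ := ha
    exact ⟨_, ih hb, _, ih hc, by group⟩

theorem inv_mem_commValues (n : ℕ) {a : G} (ha : a ∈ commValues G n) : a⁻¹ ∈ commValues G n := by
  cases n with
  | zero => trivial
  | succ n =>
    obtain ⟨b, hb, c, hc, rfl⟩ := ha
    exact ⟨c, hc, b, hb, by group⟩

theorem closure_commValues (n : ℕ) :
    Subgroup.closure (commValues G n) = derivedSeries G n := by
  induction n with
  | zero => simp [commValues]
  | succ n ih =>
    rw [derivedSeries_succ, ← ih]
    refine le_antisymm ?_ ?_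
    · rw [Subgroup.closure_le]
      rintro _ ⟨a, ha, b, hb, rfl⟩
      have := Subgroup.commutator_mem_commutator (inv_mem (Subgroup.subset_closure ha))
        (inv_mem (Subgroup.subset_closure hb))
      simpa [commutatorElement_def] using this
    · have := closure_normal_of_conj_mem fun a ha g => conj_mem_commValues (G := G) (n + 1) ha g
      refine commutator_closure_le fun a ha b hb => Subgroup.subset_closure
        ⟨_, inv_mem_commValues n ha, _, inv_mem_commValues n hb, by group⟩

theorem isLaw_solvWord_iff : IsLaw solvWord G ↔ derivedSeries G 3 = ⊥ := by
  rw [← closure_commValues, Subgroup.closure_eq_bot_iff]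
  constructor
  · rintro h _ ⟨_, ⟨_, ⟨a, -, b, -, rfl⟩, _, ⟨c, -, d, -, rfl⟩, rfl⟩, _,
      ⟨_, ⟨a', -, b', -, rfl⟩, _, ⟨c', -, d', -, rfl⟩, rfl⟩, rfl⟩
    simpa [solvWord, comm, x] using
      h (Sum.elim (fun i => [1, a, b, c, d, a', b', c', d'].getD i 1) 1)
  · intro h g
    refine h ?_
    simp only [solvWord, comm, map_mul, map_inv]
    exact ⟨_, ⟨_, ⟨_, trivial, _, trivial, rfl⟩, _, ⟨_, trivial, _, trivial, rfl⟩, rfl⟩, _,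
      ⟨_, ⟨_, trivial, _, trivial, rfl⟩, _, ⟨_, trivial, _, trivial, rfl⟩, rfl⟩, rfl⟩

theorem isLaw_solvWord_perm : IsLaw solvWord (Equiv.Perm (Fin 4)) :=
  isLaw_solvWord_iff.2 (derivedSeries_perm_eq_bot (Nat.card_fin 4))

theorem derivedSeries_finiteIndex [Group.FG G] (hG : IsMulTorsion G) (n : ℕ) :
    (derivedSeries G n).FiniteIndex := by
  induction n with
  | zero => rw [derivedSeries_zero]; infer_instance
  | succ n ih =>
    set D := derivedSeries G n
    have : Group.FG D := D.fg_of_index_ne_zero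
    have : Group.FG (Abelianization D) := QuotientGroup.fg _
    have hfin : Finite (Abelianization D) := by
      refine CommGroup.finite_of_fg_isMulTorsion _ ?_
      exact (hG.subgroup D).of_surjective (f := Abelianization.of) QuotientGroup.mk_surjective
    have hidx : (commutator D).FiniteIndex := Subgroup.finiteIndex_iff_finite_quotient.2 hfin
    rw [derivedSeries_succ, ← Subgroup.map_subtype_commutator]
    refine ⟨?_⟩
    rw [Subgroup.index_map_subtype]
    exact mul_ne_zero hidx.index_ne_zero ih.index_ne_zero

theorem finite_of_fg_of_derivedSeries_eq_bot [Group.FG G] (hG : IsMulTorsion G) {n : ℕ}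
    (hn : derivedSeries G n = ⊥) : Finite G := by
  have := derivedSeries_finiteIndex hG n
  rw [hn] at this
  refine Nat.finite_of_card_ne_zero ?_
  rw [← Subgroup.index_bot]
  exact this.index_ne_zero

end SolvableLaw

section Range

variable {G H : Type*} [Group G] [Group H]

theorem satisfies_range_iff {φ : G →* H} {δ : List F} :
    Satisfies δ φ.range ↔ ∀ g : ℕ ⊕ ℕ → G, ∃ f ∈ δ, φ (FreeGroup.lift g f) = 1 := by
  have hlift (g : ℕ ⊕ ℕ → G) (f : F) :
      FreeGroup.lift (φ.rangeRestrict ∘ g) f = φ.rangeRestrict (FreeGroup.lift g f) :=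
    (FreeGroup.lift_unique (φ.rangeRestrict.comp (FreeGroup.lift g)) (by simp)).symm
  refine ⟨fun h g => ?_, fun h g => ?_⟩
  · obtain ⟨f, hf, h1⟩ := h (φ.rangeRestrict ∘ g)
    exact ⟨f, hf, congrArg Subtype.val (hlift g f ▸ h1)⟩
  · choose g' hg' using fun i => φ.rangeRestrict_surjective (g i)
    obtain ⟨f, hf, h1⟩ := h g'
    rw [← funext hg']
    exact ⟨f, hf, (hlift g' f).trans (Subtype.ext h1)⟩

theorem isLaw_iff_satisfies_singleton {f : F} : IsLaw f G ↔ Satisfies [f] G := by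
  simp [IsLaw, Satisfies]

theorem isLaw_range_iff {φ : G →* H} {f : F} :
    IsLaw f φ.range ↔ ∀ g : ℕ ⊕ ℕ → G, φ (FreeGroup.lift g f) = 1 := by
  simp [isLaw_iff_satisfies_singleton, satisfies_range_iff]

end Range

section Evaluation

variable {K : Type w} [Field K] {G H V : Type*} [Group G] [Group H] [AddCommGroup V] [Module K V]
  {ρ : Representation K G V} {p : MonoidAlgebra K F}

theorem asAlgebraHom_mapDomainAlgHom {M N : Type*} [Monoid M] [Monoid N]
    (σ : Representation K N V) (φ : M →* N) (q : MonoidAlgebra K M) :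
    σ.asAlgebraHom (MonoidAlgebra.mapDomainAlgHom K K φ q) =
      MonoidAlgebra.lift K (Module.End K V) M (σ.comp φ) q := by
  induction q using MonoidAlgebra.induction_linear with
  | zero => simp
  | add p q hp hq => simp only [map_add, hp, hq]
  | single m r => simp [MonoidAlgebra.mapDomainAlgHom]

theorem isIdentity_iff : IsIdentity ρ p ↔ ∀ g : ℕ ⊕ ℕ → G,
    MonoidAlgebra.lift K (Module.End K V) F (MonoidHom.comp ρ (FreeGroup.lift g)) p = 0 :=
  forall_congr' fun g => by rw [asAlgebraHom_mapDomainAlgHom]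

theorem comp_lift_freeGroup (φ : H →* G) (g : ℕ ⊕ ℕ → H) :
    φ.comp (FreeGroup.lift g) = FreeGroup.lift (φ ∘ g) :=
  FreeGroup.ext_hom _ _ fun i => by simp

theorem isIdentity_comp_iff {φ : H →* G} (hφ : Function.Surjective φ) :
    IsIdentity (MonoidHom.comp ρ φ : Representation K H V) p ↔ IsIdentity ρ p := by
  simp only [isIdentity_iff, MonoidHom.comp_assoc, comp_lift_freeGroup]
  exact (hφ.comp_left.forall (p := fun g => MonoidAlgebra.lift K (Module.End K V) F
    (MonoidHom.comp ρ (FreeGroup.lift g)) p = 0)).symm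

theorem IsIdentity.comp (hp : IsIdentity ρ p) (φ : H →* G) :
    IsIdentity (MonoidHom.comp ρ φ : Representation K H V) p := by
  rw [isIdentity_iff] at hp ⊢
  intro g
  rw [MonoidHom.comp_assoc, comp_lift_freeGroup]
  exact hp (φ ∘ g)

/-- The tautological representation of the group of operators `ρ(G)`. -/
def imageRep (ρ : Representation K G V) : Representation K ρ.asGroupHom.range V :=
  (Units.coeHom _).comp (Subgroup.subtype _)

theorem isIdentity_imageRep_iff : IsIdentity (imageRep ρ) p ↔ IsIdentity ρ p := by
  rw [← isIdentity_comp_iff ρ.asGroupHom.rangeRestrict_surjective]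
  rfl

theorem asGroupHom_eq_one_iff {a : G} : ρ.asGroupHom a = 1 ↔ ρ a = 1 := by
  rw [Units.ext_iff, ρ.asGroupHom_apply, Units.val_one]

theorem isIdentity_subOne_iff {f : F} :
    IsIdentity ρ (subOne K f) ↔ IsLaw f ρ.asGroupHom.range := by
  simp only [isIdentity_iff, isLaw_range_iff, asGroupHom_eq_one_iff, subOne, map_sub,
    MonoidAlgebra.lift_of, map_one, sub_eq_zero, MonoidHom.comp_apply]

theorem IsLaw.isIdentity_subOne {f : F} (h : IsLaw f G) (ρ : Representation K G V) :
    IsIdentity ρ (subOne K f) :=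
  isIdentity_subOne_iff.2 (isLaw_range_iff.2 fun g => by rw [h g, map_one])

theorem lift_starElem {A : Type*} [Ring A] [Algebra K A] (φ : F →* A) (δ : List F) :
    MonoidAlgebra.lift K A F φ (starElem K δ) =
      (δ.mapIdx fun k f => φ ((y k)⁻¹ * f * y k) - 1).prod := by
  rw [starElem, map_list_prod]
  congr 1
  refine List.ext_getElem (by simp) fun k h₁ h₂ => ?_
  simp only [List.getElem_map, List.getElem_mapIdx, subOne, map_sub, MonoidAlgebra.lift_of,
    map_one]

theorem Satisfies.isIdentity_starElem {δ : List F} (h : Satisfies δ G)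
    (ρ : Representation K G V) : IsIdentity ρ (starElem K δ) := by
  rw [isIdentity_iff]
  intro g
  obtain ⟨f, hf, h1⟩ := h g
  obtain ⟨k, hk, rfl⟩ := List.getElem_of_mem hf
  rw [lift_starElem]
  exact List.prod_eq_zero (List.mem_mapIdx.2 ⟨k, hk, by simp [h1]⟩)

theorem IsIdentity.mapDomain_eq_zero (hp : IsIdentity (Representation.leftRegular K G) p)
    (g : ℕ ⊕ ℕ → G) : MonoidAlgebra.mapDomainAlgHom K K (FreeGroup.lift g) p = 0 := by
  have := congrArg (fun f => f 1) (hp g)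
  simpa only [Representation.asAlgebraHom_ofMulAction_smul_eq_mul, mul_one,
    LinearMap.zero_apply] using this

theorem IsIdentity.of_injective (hp : IsIdentity (Representation.leftRegular K G) p)
    {ψ : H →* G} (hψ : Function.Injective ψ) (σ : Representation K H V) : IsIdentity σ p := by
  intro g
  suffices MonoidAlgebra.mapDomainAlgHom K K (FreeGroup.lift g) p = 0 by rw [this, map_zero]
  have := hp.mapDomain_eq_zero (ψ ∘ g)
  rw [← comp_lift_freeGroup, MonoidAlgebra.mapDomainAlgHom_comp, AlgHom.comp_apply] at this
  exact MonoidAlgebra.mapDomain_injective (R := K) hψ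
    (this.trans (map_zero (MonoidAlgebra.mapDomainAlgHom K K ψ)).symm)

theorem exists_finset_lift_eq (f : F) : ∃ s : Finset (ℕ ⊕ ℕ), ∀ g g' : ℕ ⊕ ℕ → G,
    (∀ i ∈ s, g i = g' i) → FreeGroup.lift g f = FreeGroup.lift g' f := by
  classical
  induction f using FreeGroup.induction_on with
  | C1 => exact ⟨∅, by simp⟩
  | of i => exact ⟨{i}, by simp⟩
  | inv_of i _ => exact ⟨{i}, by simp +contextual⟩
  | mul a b ha hb =>
    obtain ⟨s, hs⟩ := ha
    obtain ⟨t, ht⟩ := hb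
    refine ⟨s ∪ t, fun g g' h => ?_⟩
    rw [map_mul, map_mul, hs g g' fun i hi => h i (Finset.mem_union_left _ hi),
      ht g g' fun i hi => h i (Finset.mem_union_right _ hi)]

theorem exists_finset_mapDomain_eq (p : MonoidAlgebra K F) :
    ∃ s : Finset (ℕ ⊕ ℕ), ∀ g g' : ℕ ⊕ ℕ → G, (∀ i ∈ s, g i = g' i) →
      MonoidAlgebra.mapDomainAlgHom K K (FreeGroup.lift g) p =
        MonoidAlgebra.mapDomainAlgHom K K (FreeGroup.lift g') p := by
  classical
  induction p using MonoidAlgebra.induction_linear with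
  | zero => exact ⟨∅, by simp⟩
  | add p q hp hq =>
    obtain ⟨s, hs⟩ := hp
    obtain ⟨t, ht⟩ := hq
    refine ⟨s ∪ t, fun g g' h => ?_⟩
    rw [map_add, map_add, hs g g' fun i hi => h i (Finset.mem_union_left _ hi),
      ht g g' fun i hi => h i (Finset.mem_union_right _ hi)]
  | single f r =>
    obtain ⟨s, hs⟩ := exists_finset_lift_eq (G := G) f
    exact ⟨s, fun g g' h => by simp [MonoidAlgebra.mapDomainAlgHom, hs g g' h]⟩

theorem isIdentity_of_fg (h : ∀ H : Subgroup G, H.FG →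
    IsIdentity (MonoidHom.comp ρ H.subtype : Representation K H V) p) : IsIdentity ρ p := by
  classical
  intro g
  obtain ⟨s, hs⟩ := exists_finset_mapDomain_eq (G := G) p
  let H : Subgroup G := Subgroup.closure (s.image g)
  let g' (i : ℕ ⊕ ℕ) : H :=
    if hi : i ∈ s then ⟨g i, Subgroup.subset_closure (Finset.mem_image_of_mem g hi)⟩ else 1
  rw [hs g (H.subtype ∘ g') fun i hi => by simp [g', hi], asAlgebraHom_mapDomainAlgHom,
    ← comp_lift_freeGroup]
  exact isIdentity_iff.1 (h H ⟨_, rfl⟩) g'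

end Evaluation

section Irreducible

variable {K : Type w} [Field K] {G V : Type*} [Group G] [AddCommGroup V] [Module K V]
  {ρ : Representation K G V}

/-- The vectors fixed by all conjugates of `f`, written as `ρ f (ρ b v) = ρ b v` to avoid
inverses. -/
def fixedByConjugates (ρ : Representation K G V) (f : G) : Subrepresentation ρ where
  toSubmodule := ⨅ b, LinearMap.ker ((ρ f - 1) ∘ₗ ρ b)
  apply_mem_toSubmodule g v hv := by
    simp only [Submodule.mem_iInf, LinearMap.mem_ker, LinearMap.comp_apply] at hv ⊢
    intro b
    rw [← Module.End.mul_apply (ρ b), ← map_mul]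
    exact hv (b * g)

theorem mem_fixedByConjugates_iff {f : G} {v : V} :
    v ∈ fixedByConjugates ρ f ↔ ∀ b, ρ f (ρ b v) = ρ b v := by
  change v ∈ ⨅ b, LinearMap.ker ((ρ f - 1) ∘ₗ ρ b) ↔ _
  simp [sub_eq_zero]

theorem nontrivial_of_isIrreducible [ρ.IsIrreducible] : Nontrivial V := by
  by_contra h
  rw [not_nontrivial_iff_subsingleton] at h
  exact bot_ne_top (α := Subrepresentation ρ)
    (Subrepresentation.toSubmodule_injective (Subsingleton.elim _ _))

theorem exists_apply_eq_one_of_prod_eq_zero [ρ.IsIrreducible] (l : List G)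
    (h : ∀ c : ℕ → G, (l.mapIdx fun k f => ρ ((c k)⁻¹ * f * c k) - 1).prod = 0) :
    ∃ f ∈ l, ρ f = 1 := by
  induction l with
  | nil =>
    have := nontrivial_of_isIrreducible (ρ := ρ)
    simp at h
  | cons f l ih =>
    rcases eq_bot_or_eq_top (fixedByConjugates ρ f) with hbot | htop
    · have hfixed (c : ℕ → G) (v : V) :
          (l.mapIdx fun k f => ρ ((c k)⁻¹ * f * c k) - 1).prod v ∈ fixedByConjugates ρ f := by
        refine mem_fixedByConjugates_iff.2 fun b => ?_
        have hb := h (fun k => k.casesOn b c)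
        rw [List.mapIdx_cons, List.prod_cons] at hb
        have := congrArg (fun φ => ρ b (φ v)) hb
        simpa [sub_eq_zero, map_mul] using this
      rw [hbot] at hfixed
      obtain ⟨f', hf', h1⟩ := ih fun c => LinearMap.ext (hfixed c)
      exact ⟨f', List.mem_cons_of_mem _ hf', h1⟩
    · refine ⟨f, List.mem_cons_self, LinearMap.ext fun v => ?_⟩
      have hv : v ∈ fixedByConjugates ρ f := htop ▸ trivial
      simpa using mem_fixedByConjugates_iff.1 hv 1

/-- The subgroup of words in the variables `x i` only. -/
def xWords : Subgroup F := (FreeGroup.map Sum.inl).range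

theorem x_mem_xWords (i : ℕ) : x i ∈ xWords := ⟨FreeGroup.of i, by simp [x]⟩

theorem lift_eq_of_mem_xWords {f : F} (hf : f ∈ xWords) {g g' : ℕ ⊕ ℕ → G}
    (h : ∀ i, g (Sum.inl i) = g' (Sum.inl i)) : FreeGroup.lift g f = FreeGroup.lift g' f := by
  obtain ⟨f, rfl⟩ := hf
  have : (FreeGroup.lift g).comp (FreeGroup.map Sum.inl) =
      (FreeGroup.lift g').comp (FreeGroup.map Sum.inl) :=
    FreeGroup.ext_hom _ _ fun i => by simp [h]
  exact DFunLike.congr_fun this f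

theorem IsIdentity.satisfies_range [ρ.IsIrreducible] {δ : List F} (hδ : ∀ f ∈ δ, f ∈ xWords)
    (h : IsIdentity ρ (starElem K δ)) : Satisfies δ ρ.asGroupHom.range := by
  refine satisfies_range_iff.2 fun g => ?_
  have hprod (c : ℕ → G) : ((δ.map (FreeGroup.lift g)).mapIdx fun k f =>
      ρ ((c k)⁻¹ * f * c k) - 1).prod = 0 := by
    rw [← isIdentity_iff.1 h (Sum.elim (g ∘ Sum.inl) c), lift_starElem]
    congr 1
    refine List.ext_getElem (by simp) fun k h₁ _ => ?_
    have hk : k < δ.length := by simpa using h₁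
    have hlift := lift_eq_of_mem_xWords (hδ _ (List.getElem_mem hk)) (g := g)
      (g' := Sum.elim (g ∘ Sum.inl) c) fun i => rfl
    simp [hlift, y]
  obtain ⟨_, hf', h1⟩ := exists_apply_eq_one_of_prod_eq_zero _ hprod
  obtain ⟨f, hf, rfl⟩ := List.mem_map.1 hf'
  exact ⟨f, hf, asGroupHom_eq_one_iff.2 h1⟩

end Irreducible

section Semisimple

variable {K : Type w} [Field K] {G V : Type*} [Group G] [AddCommGroup V] [Module K V]
  {ρ : Representation K G V} {p : MonoidAlgebra K F}

theorem lift_toRepresentation (W : Subrepresentation ρ) (φ : F →* G) (p : MonoidAlgebra K F)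
    (w : W.toSubmodule) :
    (MonoidAlgebra.lift K (Module.End K W.toSubmodule) F
      (MonoidHom.comp W.toRepresentation φ) p w : V) =
      MonoidAlgebra.lift K (Module.End K V) F (MonoidHom.comp ρ φ) p w := by
  induction p using MonoidAlgebra.induction_linear with
  | zero => simp
  | add p q hp hq => simp only [map_add, LinearMap.add_apply, Submodule.coe_add, hp, hq]
  | single m r => simp [Subrepresentation.toRepresentation]

theorem isIdentity_toRepresentation_iff {W : Subrepresentation ρ} :
    IsIdentity W.toRepresentation p ↔ ∀ g : ℕ ⊕ ℕ → G, ∀ w ∈ W,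
      MonoidAlgebra.lift K (Module.End K V) F (MonoidHom.comp ρ (FreeGroup.lift g)) p w = 0 := by
  simp only [isIdentity_iff, LinearMap.ext_iff, Subtype.ext_iff, lift_toRepresentation]
  exact forall_congr' fun g => Subtype.forall

theorem IsIdentity.toRepresentation (hp : IsIdentity ρ p) (W : Subrepresentation ρ) :
    IsIdentity W.toRepresentation p :=
  isIdentity_toRepresentation_iff.2 fun g w _ => by rw [isIdentity_iff.1 hp g]; rfl

theorem isIrreducible_toRepresentation_of_isAtom {W : Subrepresentation ρ} (hW : IsAtom W) :
    W.toRepresentation.IsIrreducible := by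
  have hnontrivial : Nontrivial W.toSubmodule :=
    Submodule.nontrivial_iff_ne_bot.2 fun h => hW.1 (Subrepresentation.toSubmodule_injective h)
  refine { exists_pair_ne := ⟨⊥, ⊤, fun h => bot_ne_top (α := Submodule K W.toSubmodule)
    (congrArg Subrepresentation.toSubmodule h)⟩, eq_bot_or_eq_top := fun S => ?_ }
  let S' : Subrepresentation ρ := ⟨S.toSubmodule.map W.toSubmodule.subtype, by
    rintro g _ ⟨v, hv, rfl⟩
    exact ⟨_, S.apply_mem_toSubmodule g hv, rfl⟩⟩
  have hle : S' ≤ W := by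
    rintro _ ⟨v, -, rfl⟩
    exact v.2
  have hinj := Submodule.map_injective_of_injective W.toSubmodule.subtype_injective
  refine (hW.le_iff.1 hle).imp (fun h => ?_) fun h => ?_ <;>
    refine Subrepresentation.toSubmodule_injective (hinj ?_)
  · exact (congrArg Subrepresentation.toSubmodule h).trans (Submodule.map_bot _).symm
  · exact (congrArg Subrepresentation.toSubmodule h).trans (Submodule.map_subtype_top _).symm

theorem isIdentity_of_isIrreducible [ρ.IsSemisimpleRepresentation]
    (h : ∀ W : Subrepresentation ρ, W.toRepresentation.IsIrreducible →
      IsIdentity W.toRepresentation p) : IsIdentity ρ p := by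
  have : IsSemisimpleModule (MonoidAlgebra K G) ρ.asModule :=
    ρ.isSemisimpleRepresentation_iff_isSemisimpleModule_asModule.1 inferInstance
  refine isIdentity_iff.2 fun g => LinearMap.ext fun v => ?_
  have hv : ρ.asModuleEquiv.symm v ∈ ⨆ W : {W : Submodule (MonoidAlgebra K G) ρ.asModule |
      IsSimpleModule (MonoidAlgebra K G) W}, W.1 := by
    rw [← sSup_eq_iSup', IsSemisimpleModule.sSup_simples_eq_top]
    trivial
  refine Submodule.iSup_induction _ (motive := fun m => MonoidAlgebra.lift K (Module.End K V) F
    (MonoidHom.comp ρ (FreeGroup.lift g)) p (ρ.asModuleEquiv m) = 0) hv ?_ (by simp) ?_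
  · rintro ⟨W, hW⟩ m hm
    have hatom : IsAtom (Subrepresentation.ofSubmodule' W) :=
      (OrderIso.isAtom_iff Subrepresentation.subrepresentationSubmoduleOrderIso.symm W).2
        (isSimpleModule_iff_isAtom.1 hW)
    exact isIdentity_toRepresentation_iff.1
      (h _ (isIrreducible_toRepresentation_of_isAtom hatom)) g _ hm
  · intro m n hm hn
    rw [map_add, map_add, hm, hn, add_zero]

end Semisimple

section Words

theorem memPowers_subset_xWords {a b : F} (ha : a ∈ xWords) (hb : b ∈ xWords) :
    ∀ f ∈ memPowers a b, f ∈ xWords := by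
  simp [memPowers, ha, hb, mul_mem, pow_mem]

theorem omega_subset_xWords (n : ℕ) : ∀ f ∈ omega n, f ∈ xWords := by
  intro f hf
  obtain ⟨i, j, -, -, rfl⟩ := mem_omega_iff.1 hf
  exact mul_mem (x_mem_xWords i) (inv_mem (x_mem_xWords j))

theorem delta10_subset_xWords : ∀ f ∈ delta10, f ∈ xWords := by
  have h1 := x_mem_xWords 1
  have h2 := x_mem_xWords 2
  simp only [delta10, List.forall_mem_cons]
  exact ⟨pow_mem h1 4, pow_mem h2 4, pow_mem (mul_mem h1 h2) 4,
    pow_mem (mul_mem h1 (pow_mem h2 2)) 4, by simp⟩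

theorem delta11_subset_xWords : ∀ f ∈ delta11, f ∈ xWords := by
  simp [delta11, x_mem_xWords, pow_mem]

theorem delta12_subset_xWords : ∀ f ∈ delta12, f ∈ xWords := by
  simp [delta12, x_mem_xWords, mul_mem, pow_mem]

theorem delta13_subset_xWords : ∀ f ∈ delta13, f ∈ xWords := by
  intro f hf
  simp only [delta13, theta, List.mem_append, List.mem_flatMap] at hf
  rcases hf with hf | (⟨⟨i, j⟩, -, hf⟩ | ⟨⟨i, j, k⟩, -, hf⟩) | ⟨⟨i, j, k⟩, -, hf⟩
  · revert f
    simp [x_mem_xWords, mul_mem, pow_mem]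
  all_goals
    refine memPowers_subset_xWords ?_ ?_ f hf <;> simp only [x_mem_xWords, mul_mem]

end Words

section Criterion

variable {K : Type w} [Field K] {G₀ : Type*} [Group G₀] {Δ : Set (List F)} {E : Set F}

theorem IsIdentity.of_natCard_ne_zero {G : Type*} [Group G] {V : Type v} [AddCommGroup V]
    [Module K V] {ρ : Representation K G V} {p : MonoidAlgebra K F}
    (hp : IsIdentity (Representation.leftRegular K G₀) p) (hG : (Nat.card G : K) ≠ 0)
    (hx : ∀ δ ∈ Δ, ∀ f ∈ δ, f ∈ xWords)
    (hemb : ∀ (Q : Type v) [Group Q] [Finite Q], (∀ δ ∈ Δ, Satisfies δ Q) →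
      ∃ ψ : Q →* G₀, Function.Injective ψ)
    (hρ : ∀ δ ∈ Δ, IsIdentity ρ (starElem K δ)) : IsIdentity ρ p := by
  have : NeZero (Nat.card G : K) := ⟨hG⟩
  have : Finite G := Nat.finite_of_card_ne_zero fun h0 => hG (by rw [h0, Nat.cast_zero])
  refine isIdentity_of_isIrreducible fun W _ => isIdentity_imageRep_iff.1 ?_
  have : Finite W.toRepresentation.asGroupHom.range :=
    Finite.of_surjective _ W.toRepresentation.asGroupHom.rangeRestrict_surjective
  obtain ⟨ψ, hψ⟩ := hemb W.toRepresentation.asGroupHom.range fun δ hδ =>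
    ((hρ δ hδ).toRepresentation W).satisfies_range (hx δ hδ)
  exact hp.of_injective hψ _

/-- Since `Nat.card` of an infinite group is `0`, the hypothesis `hfin` also says that finitely
generated groups with the laws in `E` are finite. -/
theorem isBasisOfIdentities_leftRegular (hx : ∀ δ ∈ Δ, ∀ f ∈ δ, f ∈ xWords)
    (hΔ : ∀ δ ∈ Δ, Satisfies δ G₀) (hE : ∀ f ∈ E, IsLaw f G₀)
    (hemb : ∀ (Q : Type v) [Group Q] [Finite Q], (∀ δ ∈ Δ, Satisfies δ Q) →
      ∃ ψ : Q →* G₀, Function.Injective ψ)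
    (hfin : ∀ (H : Type v) [Group H] [Group.FG H], (∀ f ∈ E, IsLaw f H) →
      (Nat.card H : K) ≠ 0) :
    IsBasisOfIdentities.{u, v} (starElem K '' Δ ∪ subOne K '' E)
      (Representation.leftRegular K G₀) := by
  have hU : starElem K '' Δ ∪ subOne K '' E ⊆ identities (Representation.leftRegular K G₀) := by
    rintro _ (⟨δ, hδ, rfl⟩ | ⟨f, hf, rfl⟩)
    · exact (hΔ δ hδ).isIdentity_starElem _
    · exact (hE f hf).isIdentity_subOne _
  refine ⟨hU, fun G V _ _ _ ρ => ⟨fun h p hp => isIdentity_of_fg fun H hH => ?_,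
    fun h p hp => h p (hU hp)⟩⟩
  let σ : Representation K H V := MonoidHom.comp ρ H.subtype
  have hσ (q) (hq : q ∈ starElem K '' Δ ∪ subOne K '' E) : IsIdentity σ q :=
    (h q hq).comp H.subtype
  have : Group.FG H := (Group.fg_iff_subgroup_fg H).2 hH
  have hcard : (Nat.card σ.asGroupHom.range : K) ≠ 0 :=
    hfin _ fun f hf => isIdentity_subOne_iff.1 (hσ _ (.inr ⟨f, hf, rfl⟩))
  exact isIdentity_imageRep_iff.1 (hp.of_natCard_ne_zero hcard hx hemb fun δ hδ =>
    isIdentity_imageRep_iff.2 (hσ _ (.inl ⟨δ, hδ, rfl⟩)))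

end Criterion

section BasisS4

variable {K : Type w} [Field K]

theorem natCard_cast_ne_zero (h2 : ringChar K ≠ 2) (h3 : ringChar K ≠ 3) (G : Type*) [Group G]
    [Finite G] (h12 : ∀ g : G, g ^ 12 = 1) : (Nat.card G : K) ≠ 0 := by
  intro h0
  have hdvd : ringChar K ∣ Nat.card G := (ringChar.spec K _).1 h0
  have hp : (ringChar K).Prime := (CharP.char_is_prime_or_zero K (ringChar K)).resolve_right
    fun h => Nat.card_pos.ne' (Nat.eq_zero_of_zero_dvd (h ▸ hdvd))
  have : Fact (ringChar K).Prime := ⟨hp⟩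
  obtain ⟨g, hg⟩ := exists_prime_orderOf_dvd_card' _ hdvd
  have hd : ringChar K ∣ 2 ^ 2 * 3 := hg ▸ orderOf_dvd_of_pow_eq_one (h12 g)
  rcases hp.dvd_mul.1 hd with h | h
  · exact h2 ((Nat.prime_dvd_prime_iff_eq hp Nat.prime_two).1 (hp.dvd_of_dvd_pow h))
  · exact h3 ((Nat.prime_dvd_prime_iff_eq hp Nat.prime_three).1 h)

theorem natCard_cast_ne_zero_of_isLaw (h2 : ringChar K ≠ 2) (h3 : ringChar K ≠ 3) (H : Type*)
    [Group H] [Group.FG H] (h12 : IsLaw (x 1 ^ 12) H) (hsolv : IsLaw solvWord H) :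
    (Nat.card H : K) ≠ 0 := by
  have hpow (g : H) : g ^ 12 = 1 := by simpa [x] using h12 fun _ => g
  have : Finite H := finite_of_fg_of_derivedSeries_eq_bot
    (fun g => isOfFinOrder_iff_pow_eq_one.2 ⟨12, by norm_num, hpow g⟩)
    (isLaw_solvWord_iff.1 hsolv)
  exact natCard_cast_ne_zero h2 h3 H hpow

theorem basisS4_eq : basisS4 K =
    starElem K '' {omega 24, delta10, delta11, delta12, delta13} ∪
      subOne K '' {x 1 ^ 12, solvWord} := by
  simp only [basisS4, Set.image_insert_eq, Set.image_singleton, Set.insert_union,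
    Set.singleton_union]

end BasisS4

end RegIdentities

theorem proposition6 (K : Type w) [Field K] (h2 : ringChar K ≠ 2) (h3 : ringChar K ≠ 3) :
    RegIdentities.IsBasisOfIdentities.{u, v, w, 0, w} (RegIdentities.basisS4 K)
      (Representation.leftRegular K (Equiv.Perm (Fin 4))) := by
  open RegIdentities in
  rw [basisS4_eq]
  apply isBasisOfIdentities_leftRegular <;>
    simp only [Set.forall_mem_insert, Set.mem_singleton_iff, forall_eq]
  · exact ⟨omega_subset_xWords 24, delta10_subset_xWords, delta11_subset_xWords,
      delta12_subset_xWords, delta13_subset_xWords⟩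
  · exact ⟨satisfies_omega_perm, satisfies_delta10_perm, satisfies_delta11_perm,
      satisfies_delta12_perm, satisfies_delta13_perm⟩
  · exact ⟨isLaw_pow_twelve_perm, isLaw_solvWord_perm⟩
  · rintro Q _ _ ⟨h24, h10, h11, h12, h13⟩
    exact exists_embedding_of_satisfies h24 h10 h11 h12 h13
  · rintro H _ _ ⟨h12, hsolv⟩
    exact natCard_cast_ne_zero_of_isLaw h2 h3 H h12 hsolv
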